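/- **Theorem (Poincaré–Dulac normal form).** Let $\mathbb K$ be $\mathbb R$ or $\mathbb C$ and let $f=(f^{(1)},\dots,f^{(n)})\in\mathbb K[[x_1,\dots,x_n]]^n$ be a formal vector field with $f(0)=0$, written as $$f(x)=Ax+\sum_{j\ge 2}f_j(x),\qquad A=Df(0)\in\mathbb K^{n\times n},$$ with each $f_j$ a homogeneous polynomial vector field of degree $j$. Let $A=A_s+A_n$ be the Jordan–Chevalley decomposition of $A$ ($A_s$ semisimple, $A_n$ nilpotent, $A_sA_n=A_nA_s$), and for formal vector fields $g,h$ let $[g,h]=Dh\cdot g-Dg\cdot h$, where a matrix $B$ is identified with the linear vector field $x\mapsto Bx$. Then there exist $\Phi,f^*\in\mathbb K[[x_1,\dots,x_n]]^n$ of the form $$\Phi(x)=x+\text{(terms of degree}\ge 2),\qquad f^*(x)=Ax+\sum_{j\ge 2}f_j^*(x),$$ with each $f_j^*$ homogeneous of degree $j$, such that 1. $\Phi$ is formally solution-preserving from $\dot x=f^*(x)$ to $\dot x=f(x)$, i.e. $D\Phi(x)\,f^*(x)=f(\Phi(x))$ as formal power series; 2. $f^*$ is in Poincaré–Dulac normal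 form, i.e. $[A_s,f^*]=0$. Moreover, for every formal vector field $g=A+\sum_{j\ge2}g_j$ ($g_j$ homogeneous of degree $j$), one has $[A_s,g]=0$ if and only if $[A_s,g_j]=0$ for all $j\ge 2$; in particular $[A_s,f_j^*]=0$ for all $j\ge2$. -/

import Mathlib

noncomputable section

namespace PoincareDulac

/-- `B = S + N` is the Jordan–Chevalley decomposition of `B`: `S` is semisimple, `N` is nilpotent
and `S`, `N` commute. -/
structure IsJordanChevalley {𝕜 : Type*} [Field 𝕜] {n : ℕ} (B S N : Matrix (Fin n) (Fin n) 𝕜) :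
    Prop where
  add_eq : B = S + N
  semisimple : Module.End.IsSemisimple (Matrix.toLin' S)
  nilpotent : IsNilpotent N
  commute : Commute S N

theorem exists_isJordanChevalley {𝕜 : Type*} [Field 𝕜] [PerfectField 𝕜] {n : ℕ}
    (B : Matrix (Fin n) (Fin n) 𝕜) : ∃ S, ∃ N, IsJordanChevalley B S N := by
  let e : Matrix (Fin n) (Fin n) 𝕜 ≃ₐ[𝕜] Module.End 𝕜 (Fin n → 𝕜) := Matrix.toLinAlgEquiv'
  obtain ⟨N, hN, S, hS, hnil, hss, h⟩ :=
    Module.End.exists_isNilpotent_isSemisimple (K := 𝕜) (f := e B)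
  have hc : Commute S N := Algebra.commute_of_mem_adjoin_singleton_of_commute hN
    (Algebra.commute_of_mem_adjoin_self hS).symm
  refine ⟨e.symm S, e.symm N, ?_, ?_, hnil.map e.symm, hc.map e.symm⟩
  · rw [← map_add, add_comm, ← h, AlgEquiv.symm_apply_apply]
  · have hS' : Matrix.toLin' (e.symm S) = S := e.apply_symm_apply S
    rwa [hS']

theorem IsJordanChevalley.unique {𝕜 : Type*} [Field 𝕜] [PerfectField 𝕜] {n : ℕ}
    {B S N S' N' : Matrix (Fin n) (Fin n) 𝕜} (h : IsJordanChevalley B S N)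
    (h' : IsJordanChevalley B S' N') : S = S' := by
  have := Module.End.isNilpotent_isSemisimple_unique
    (h.nilpotent.map (Matrix.toLinAlgEquiv' (R := 𝕜) (n := Fin n))) h.semisimple
    (h'.nilpotent.map (Matrix.toLinAlgEquiv' (R := 𝕜) (n := Fin n))) h'.semisimple
    (h.commute.symm.map (Matrix.toLinAlgEquiv' (R := 𝕜) (n := Fin n)))
    (h'.commute.symm.map (Matrix.toLinAlgEquiv' (R := 𝕜) (n := Fin n)))
    (by
      have e := h.add_eq.symm.trans h'.add_eq
      rw [add_comm S, add_comm S'] at e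
      have e' := congrArg (Matrix.toLinAlgEquiv' (R := 𝕜) (n := Fin n)) e
      rw [map_add, map_add] at e'
      exact e')
  exact (Matrix.toLin' (R := 𝕜)).injective this.2

/-- The semisimple part `B_s` in the (unique) Jordan–Chevalley decomposition `B = B_s + B_n`. -/
def semisimplePart {𝕜 : Type*} [Field 𝕜] [PerfectField 𝕜] {n : ℕ}
    (B : Matrix (Fin n) (Fin n) 𝕜) : Matrix (Fin n) (Fin n) 𝕜 :=
  Classical.choose (exists_isJordanChevalley B)

/-- Formal vector fields on `𝕜ⁿ`, and formal maps from `𝕜ⁿ` to itself: `n`-tuples of formal power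
series in `n` variables. -/
abbrev FormalField (𝕜 : Type*) (n : ℕ) : Type _ := Fin n → MvPowerSeries (Fin n) 𝕜

/-- The formal Jacobian matrix `Dg`. -/
def jacobian {𝕜 : Type*} [Field 𝕜] {n : ℕ} (g : FormalField 𝕜 n) :
    Matrix (Fin n) (Fin n) (MvPowerSeries (Fin n) 𝕜) :=
  Matrix.of fun i j => MvPowerSeries.pderiv 𝕜 j (g i)

/-- `g(x) = Bx + ⋯`, that is, `g(0) = 0` and `Dg(0) = B`. -/
structure HasLinearPart {𝕜 : Type*} [Field 𝕜] {n : ℕ} (g : FormalField 𝕜 n)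
    (B : Matrix (Fin n) (Fin n) 𝕜) : Prop where
  map_zero : ∀ i, MvPowerSeries.constantCoeff (g i) = 0
  jacobian_zero : (jacobian g).map (fun φ => MvPowerSeries.constantCoeff φ) = B

/-- The linear vector field `x ↦ Bx`. -/
def linearField {𝕜 : Type*} [Field 𝕜] {n : ℕ} (B : Matrix (Fin n) (Fin n) 𝕜) :
    FormalField 𝕜 n :=
  (B.map fun b => (MvPowerSeries.C b : MvPowerSeries (Fin n) 𝕜)).mulVec MvPowerSeries.X

/-- The Lie bracket `[f, g] = Dg · f - Df · g`. -/
def lieBracket {𝕜 : Type*} [Field 𝕜] {n : ℕ} (f g : FormalField 𝕜 n) : FormalField 𝕜 n :=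
  (jacobian g).mulVec f - (jacobian f).mulVec g

/-- The homogeneous part `g_j` of degree `j` of `g`. -/
def homogeneousPart {𝕜 : Type*} [Field 𝕜] {n : ℕ} (j : ℕ) (g : FormalField 𝕜 n) :
    FormalField 𝕜 n :=
  fun i => MvPowerSeries.homogeneousComponent j (g i)

/-- The formal composition `g ∘ Φ` (meaningful when `Φ(0) = 0`). -/
def comp {𝕜 : Type*} [Field 𝕜] {n : ℕ} (g Φ : FormalField 𝕜 n) : FormalField 𝕜 n :=
  fun i => MvPowerSeries.subst Φ (g i)

/-- `Φ` is formally solution-preserving from `ẋ = f(x)` to `ẋ = g(x)`: one has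
`DΦ · f = g ∘ Φ` in formal power series. -/
def IsSolutionPreserving {𝕜 : Type*} [Field 𝕜] {n : ℕ} (Φ f g : FormalField 𝕜 n) : Prop :=
  (jacobian Φ).mulVec f = comp g Φ

/-- A formal vector field `g` with linear part `B` is in Poincaré–Dulac normal form:
`[B_s, g] = 0`. -/
def IsNormalForm {𝕜 : Type*} [Field 𝕜] [PerfectField 𝕜] {n : ℕ}
    (B : Matrix (Fin n) (Fin n) 𝕜) (g : FormalField 𝕜 n) : Prop :=
  lieBracket (linearField (semisimplePart B)) g = 0

end PoincareDulac

end

/-! The normal form is built degree by degree. If `(Φ, F)` satisfies `DΦ · F = f ∘ Φ` up to terms of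
order `d ≥ 2`, adding terms `h`, `k` of order `d` to `Φ`, `F` changes the defect by `k + [A, h]`
modulo order `d + 1` (`defect_add_mem_orderIdeal`). So the degree `d` part of the defect is removed
by solving `k + [A, h] = e` with `[A_s, k] = 0`, which is `exists_homological_solution`. The
corrections have growing order, so they converge coefficientwise, and the limit has zero defect.

The homological equation is linear algebra on homogeneous fields of degree `d`: `ad A = ad A_s + ad
A_n` with commuting semisimple and nilpotent summands, and Fitting's decomposition shows that `ker
(ad A_s)` and the range of `ad A` span. Semisimplicity is obtained without eigenvectors, hence also
over the reals: multiplication by the variables presents degree `j + 1` as a quotient of `n` copies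
of degree `j`, compatibly with the linear derivations (`sumXMul_comp`), so everything follows by
induction on the degree. -/

noncomputable section

namespace PoincareDulac

open MvPowerSeries

/-! ### Order filtration, coefficientwise limits and division by the variables. -/

section PowerSeries

variable {σ 𝕜 : Type*} [Field 𝕜]

/-- The ideal of power series without terms of degree less than `d`. -/
def orderIdeal (σ 𝕜 : Type*) [Field 𝕜] (d : ℕ) : Ideal (MvPowerSeries σ 𝕜) where
  carrier := {φ | (d : ℕ∞) ≤ φ.order}
  add_mem' ha hb := (le_min ha hb).trans min_order_le_add
  zero_mem' := by simp
  smul_mem' c _ hφ := (hφ.trans le_add_self).trans (le_order_mul (f := c))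

theorem mem_orderIdeal_iff_le_order {d : ℕ} {φ : MvPowerSeries σ 𝕜} :
    φ ∈ orderIdeal σ 𝕜 d ↔ (d : ℕ∞) ≤ φ.order := Iff.rfl

theorem mem_orderIdeal {d : ℕ} {φ : MvPowerSeries σ 𝕜} :
    φ ∈ orderIdeal σ 𝕜 d ↔ ∀ m : σ →₀ ℕ, m.degree < d → coeff m φ = 0 :=
  ⟨fun h _ hm => coeff_of_lt_order ((Nat.cast_lt.mpr hm).trans_le h), nat_le_order⟩

theorem orderIdeal_anti {d e : ℕ} (h : d ≤ e) : orderIdeal σ 𝕜 e ≤ orderIdeal σ 𝕜 d :=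
  fun _ hφ => mem_orderIdeal_iff_le_order.mpr ((Nat.cast_le.mpr h).trans hφ)

theorem mem_orderIdeal_zero (φ : MvPowerSeries σ 𝕜) : φ ∈ orderIdeal σ 𝕜 0 :=
  mem_orderIdeal.mpr fun _ h => absurd h (Nat.not_lt_zero _)

theorem mul_mem_orderIdeal {d e k : ℕ} {φ ψ : MvPowerSeries σ 𝕜} (hφ : φ ∈ orderIdeal σ 𝕜 d)
    (hψ : ψ ∈ orderIdeal σ 𝕜 e) (hk : k ≤ d + e) : φ * ψ ∈ orderIdeal σ 𝕜 k := by
  refine orderIdeal_anti hk ?_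
  rw [mem_orderIdeal_iff_le_order] at *
  push_cast
  exact (add_le_add hφ hψ).trans le_order_mul

theorem mem_orderIdeal_one {φ : MvPowerSeries σ 𝕜} :
    φ ∈ orderIdeal σ 𝕜 1 ↔ constantCoeff φ = 0 := by
  rw [mem_orderIdeal_iff_le_order, Nat.cast_one, one_le_order_iff_constCoeff_eq_zero]

theorem mem_orderIdeal_two {φ : MvPowerSeries σ 𝕜} :
    φ ∈ orderIdeal σ 𝕜 2 ↔
      constantCoeff φ = 0 ∧ ∀ i, constantCoeff (pderiv 𝕜 i φ) = 0 := by
  rw [mem_orderIdeal]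
  have key : ∀ i, constantCoeff (pderiv 𝕜 i φ) = coeff (Finsupp.single i 1) φ := fun i => by
    rw [← coeff_zero_eq_constantCoeff_apply, coeff_pderiv]; simp
  simp only [key]
  refine ⟨fun h => ⟨?_, fun i => h _ (by simp)⟩, fun ⟨h0, h1⟩ m hm => ?_⟩
  · rw [← coeff_zero_eq_constantCoeff_apply]; exact h _ (by simp)
  · obtain h | h : m.degree = 0 ∨ m.degree = 1 := by omega
    · rw [Finsupp.degree_eq_zero_iff] at h
      rw [h, coeff_zero_eq_constantCoeff_apply, h0]
    · obtain ⟨i, rfl⟩ := Finsupp.range_single_one.ge h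
      exact h1 i

theorem pderiv_mem_orderIdeal {d : ℕ} {φ : MvPowerSeries σ 𝕜} (i : σ)
    (hφ : φ ∈ orderIdeal σ 𝕜 (d + 1)) : pderiv 𝕜 i φ ∈ orderIdeal σ 𝕜 d := by
  rw [mem_orderIdeal] at *
  intro m hm
  rw [coeff_pderiv, hφ _ (by simpa using hm), zero_mul]

theorem X_mem_orderIdeal_one (i : σ) : (X i : MvPowerSeries σ 𝕜) ∈ orderIdeal σ 𝕜 1 :=
  mem_orderIdeal_one.mpr (constantCoeff_X i)

theorem eq_zero_of_forall_mem_orderIdeal {φ : MvPowerSeries σ 𝕜} {k : ℕ}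
    (h : ∀ d, k ≤ d → φ ∈ orderIdeal σ 𝕜 d) : φ = 0 := by
  ext m
  exact mem_orderIdeal.mp (h (max k (m.degree + 1)) (le_max_left _ _)) m
    (lt_of_lt_of_le (Nat.lt_succ_self _) (le_max_right _ _))

/-- A series congruent to zero in degrees below `d` whose homogeneous part of degree `d` vanishes
has no terms of degree at most `d`. -/
theorem mem_orderIdeal_succ {d : ℕ} {φ : MvPowerSeries σ 𝕜} (h : φ ∈ orderIdeal σ 𝕜 d)
    (h' : homogeneousComponent d φ = 0) : φ ∈ orderIdeal σ 𝕜 (d + 1) := by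
  rw [mem_orderIdeal] at *
  intro m hm
  obtain hm | rfl := Nat.lt_succ_iff_lt_or_eq.mp hm
  · exact h m hm
  · simpa [coeff_homogeneousComponent] using congrArg (coeff m) h'

theorem mem_orderIdeal_of_isHomogeneous {d : ℕ} {φ : MvPowerSeries σ 𝕜} (h : φ.IsHomogeneous d) :
    φ ∈ orderIdeal σ 𝕜 d :=
  mem_orderIdeal.mpr fun _ hm => h.coeff_eq_zero hm.ne

/-- A sequence of series stabilizing in every degree has a limit. -/
theorem exists_limit_of_stabilizing (u : ℕ → MvPowerSeries σ 𝕜) (k : ℕ)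
    (hu : ∀ d, u (d + 1) - u d ∈ orderIdeal σ 𝕜 (d + k)) :
    ∃ φ : MvPowerSeries σ 𝕜, ∀ d, φ - u d ∈ orderIdeal σ 𝕜 (d + k) := by
  have hu' : ∀ d e, u (d + e) - u d ∈ orderIdeal σ 𝕜 (d + k) := by
    intro d e
    induction e with
    | zero => simp
    | succ e ih =>
      have := (orderIdeal σ 𝕜 (d + k)).add_mem (orderIdeal_anti (by omega) (hu (d + e))) ih
      simpa [add_assoc] using this
  -- From stage `m.degree + 1` on, the coefficient at `m` no longer changes, whatever `k` is.
  let φ : MvPowerSeries σ 𝕜 := fun m => coeff m (u (m.degree + 1))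
  have hφ : ∀ m, coeff m φ = coeff m (u (m.degree + 1)) := fun _ => rfl
  refine ⟨φ, fun d => mem_orderIdeal.mpr fun m hm => ?_⟩
  rw [map_sub, sub_eq_zero, hφ]
  have h1 := mem_orderIdeal.mp (hu' (m.degree + 1) d) m (by omega)
  have h2 := mem_orderIdeal.mp (hu' d (m.degree + 1)) m hm
  rw [map_sub, sub_eq_zero] at h1 h2
  rw [← h1, ← h2, add_comm]

theorem coeff_X_mul' [DecidableEq σ] (i : σ) (φ : MvPowerSeries σ 𝕜) (m : σ →₀ ℕ) :
    coeff m (X i * φ) = if m i = 0 then 0 else coeff (m - Finsupp.single i 1) φ := by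
  rw [X, coeff_monomial_mul]
  by_cases h : m i = 0 <;> simp [h, Nat.one_le_iff_ne_zero]

/-- The series `q_i` in a decomposition `φ = φ(0) + ∑ x_i q_i`. -/
def hadamardQuotient (i : σ) (φ : MvPowerSeries σ 𝕜) : MvPowerSeries σ 𝕜 :=
  fun m => ((m i + 1 : ℕ) : 𝕜) / ((m.degree + 1 : ℕ) : 𝕜) * coeff (m + Finsupp.single i 1) φ

theorem coeff_hadamardQuotient (i : σ) (φ : MvPowerSeries σ 𝕜) (m : σ →₀ ℕ) :
    coeff m (hadamardQuotient i φ) =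
      ((m i + 1 : ℕ) : 𝕜) / ((m.degree + 1 : ℕ) : 𝕜) * coeff (m + Finsupp.single i 1) φ := rfl

theorem constantCoeff_hadamardQuotient (i : σ) (φ : MvPowerSeries σ 𝕜) :
    constantCoeff (hadamardQuotient i φ) = constantCoeff (pderiv 𝕜 i φ) := by
  rw [← coeff_zero_eq_constantCoeff_apply, ← coeff_zero_eq_constantCoeff_apply,
    coeff_hadamardQuotient, coeff_pderiv]
  simp

theorem isHomogeneous_hadamardQuotient {d : ℕ} {φ : MvPowerSeries σ 𝕜}
    (h : φ.IsHomogeneous (d + 1)) (i : σ) : (hadamardQuotient i φ).IsHomogeneous d := by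
  intro m hm
  rw [coeff_hadamardQuotient] at hm
  have := h (right_ne_zero_of_mul hm)
  rw [map_add] at this
  simpa [Finsupp.weight_single] using this

/-- This is Euler's identity: the `i`-th summand carries the fraction `m i / m.degree` of the
coefficient at `m ≠ 0`, and these fractions add up to one. Formally, the quotient is the integral of
`∂ᵢφ(tx)` over `0 ≤ t ≤ 1`. -/
theorem eq_C_add_sum_X_mul_hadamardQuotient [Fintype σ] [CharZero 𝕜] (φ : MvPowerSeries σ 𝕜) :
    φ = C (constantCoeff φ) + ∑ i, X i * hadamardQuotient i φ := by
  classical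
  ext m
  rw [map_add, map_sum, coeff_C]
  by_cases hm : m = 0
  · subst hm
    simp [coeff_X_mul']
  · have hd : (m.degree : 𝕜) ≠ 0 := by
      rw [Nat.cast_ne_zero]; exact fun h => hm ((Finsupp.degree_eq_zero_iff m).mp h)
    have : ∀ i, coeff m (X i * hadamardQuotient i φ) = (m i : 𝕜) / (m.degree : 𝕜) * coeff m φ := by
      intro i
      rw [coeff_X_mul']
      split_ifs with h
      · simp [h]
      · have hle : Finsupp.single i 1 ≤ m := by simpa [Nat.one_le_iff_ne_zero] using h
        have h1 : (m - Finsupp.single i 1) + Finsupp.single i 1 = m := tsub_add_cancel_of_le hle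
        have h2 : (m - Finsupp.single i 1).degree + 1 = m.degree := by
          conv_rhs => rw [← h1]
          simp
        have h3 : (m - Finsupp.single i 1 : σ →₀ ℕ) i + 1 = m i := by
          simp; omega
        rw [coeff_hadamardQuotient, h1, h2, h3]
    simp only [this, if_neg hm, zero_add]
    rw [← Finset.sum_mul, ← Finset.sum_div, ← Nat.cast_sum, ← Finsupp.degree_eq_sum, div_self hd,
      one_mul]

end PowerSeries

/-! ### Substitution and its first-order Taylor expansion. -/

section Substitution

variable {n : ℕ} {𝕜 : Type*} [Field 𝕜] {Φ Ψ : FormalField 𝕜 n}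

theorem hasSubst_of_mem_orderIdeal (hΦ : ∀ i, Φ i ∈ orderIdeal (Fin n) 𝕜 1) : HasSubst Φ :=
  hasSubst_of_constantCoeff_zero fun i => mem_orderIdeal_one.mp (hΦ i)

variable [CharZero 𝕜]

theorem subst_eq_C_add_sum (hΦ : ∀ i, Φ i ∈ orderIdeal (Fin n) 𝕜 1)
    (φ : MvPowerSeries (Fin n) 𝕜) :
    subst Φ φ = C (constantCoeff φ) + ∑ i, Φ i * subst Φ (hadamardQuotient i φ) := by
  have hs := hasSubst_of_mem_orderIdeal hΦ
  conv_lhs => rw [eq_C_add_sum_X_mul_hadamardQuotient φ]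
  rw [← coe_substAlgHom hs, map_add, map_sum]
  simp only [map_mul, substAlgHom_X]
  rw [coe_substAlgHom hs, subst_C]

/-- Splitting off one variable leaves a term with factor `Ψ i - Φ i`, already of the right order,
and a term where the factor `Φ i` supplies the order missing from the inductive bound. The induction
must range over all `φ`, as it is applied to the quotients. -/
theorem subst_sub_subst_mem_orderIdeal {d : ℕ} (hΦ : ∀ i, Φ i ∈ orderIdeal (Fin n) 𝕜 1)
    (hΨ : ∀ i, Ψ i ∈ orderIdeal (Fin n) 𝕜 1) (h : ∀ i, Ψ i - Φ i ∈ orderIdeal (Fin n) 𝕜 d)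
    (φ : MvPowerSeries (Fin n) 𝕜) : subst Ψ φ - subst Φ φ ∈ orderIdeal (Fin n) 𝕜 d := by
  induction d generalizing φ with
  | zero => exact mem_orderIdeal_zero _
  | succ d ih =>
    rw [subst_eq_C_add_sum hΦ φ, subst_eq_C_add_sum hΨ φ, add_sub_add_left_eq_sub,
      ← Finset.sum_sub_distrib]
    refine Ideal.sum_mem _ fun i _ => ?_
    have e : Ψ i * subst Ψ (hadamardQuotient i φ) - Φ i * subst Φ (hadamardQuotient i φ) =
        (Ψ i - Φ i) * subst Ψ (hadamardQuotient i φ) +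
        Φ i * (subst Ψ (hadamardQuotient i φ) - subst Φ (hadamardQuotient i φ)) := by ring
    rw [e]
    exact add_mem (Ideal.mul_mem_right _ _ (h i))
      (mul_mem_orderIdeal (hΦ i) (ih (fun i => orderIdeal_anti d.le_succ (h i)) _) (by omega))

/-- First-order Taylor expansion of `φ(Ψ) - φ(Φ)`. -/
theorem subst_sub_subst_sub_linear_mem_orderIdeal {d : ℕ}
    (hΦ : ∀ i, Φ i ∈ orderIdeal (Fin n) 𝕜 1)
    (hΨ : ∀ i, Ψ i ∈ orderIdeal (Fin n) 𝕜 1) (h : ∀ i, Ψ i - Φ i ∈ orderIdeal (Fin n) 𝕜 d)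
    (φ : MvPowerSeries (Fin n) 𝕜) :
    subst Ψ φ - subst Φ φ - ∑ i, C (constantCoeff (pderiv 𝕜 i φ)) * (Ψ i - Φ i) ∈
      orderIdeal (Fin n) 𝕜 (d + 1) := by
  rw [subst_eq_C_add_sum hΦ φ, subst_eq_C_add_sum hΨ φ, add_sub_add_left_eq_sub,
    ← Finset.sum_sub_distrib, ← Finset.sum_sub_distrib]
  refine Ideal.sum_mem _ fun i _ => ?_
  have e : Ψ i * subst Ψ (hadamardQuotient i φ) - Φ i * subst Φ (hadamardQuotient i φ) -
        C (constantCoeff (pderiv 𝕜 i φ)) * (Ψ i - Φ i) =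
      (Ψ i - Φ i) * (subst Ψ (hadamardQuotient i φ) - C (constantCoeff (pderiv 𝕜 i φ))) +
      Φ i * (subst Ψ (hadamardQuotient i φ) - subst Φ (hadamardQuotient i φ)) := by ring
  rw [e]
  refine add_mem (mul_mem_orderIdeal (h i) (e := 1) ?_ le_rfl)
    (mul_mem_orderIdeal (hΦ i) (subst_sub_subst_mem_orderIdeal hΦ hΨ h _) (by omega))
  -- The quotient takes the value `∂ᵢφ(0)` at the origin, so subtracting it leaves no constant term.
  rw [subst_eq_C_add_sum hΨ, constantCoeff_hadamardQuotient, add_sub_cancel_left]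
  exact Ideal.sum_mem _ fun j _ => Ideal.mul_mem_right _ _ (hΨ j)

end Substitution

/-! ### Semisimple and nilpotent operators, their quotients and commuting sums. -/

section LinearAlgebra

open Polynomial Module

variable {ι 𝕜 V W : Type*} [Field 𝕜] [AddCommGroup V] [Module 𝕜 V] [AddCommGroup W] [Module 𝕜 W]

theorem comp_aeval_of_comp_eq {π : V →ₗ[𝕜] W} {f : End 𝕜 V} {g : End 𝕜 W}
    (h : π ∘ₗ f = g ∘ₗ π) (p : 𝕜[X]) : π ∘ₗ aeval f p = aeval g p ∘ₗ π := by
  induction p using Polynomial.induction_on' with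
  | add p q hp hq => rw [map_add, map_add, LinearMap.comp_add, LinearMap.add_comp, hp, hq]
  | monomial k a =>
    have hk : π ∘ₗ (f ^ k) = (g ^ k) ∘ₗ π := by
      induction k with
      | zero => rfl
      | succ k ih =>
        rw [pow_succ, pow_succ, Module.End.mul_eq_comp, Module.End.mul_eq_comp,
          ← LinearMap.comp_assoc, ih, LinearMap.comp_assoc, h, LinearMap.comp_assoc]
    ext v
    simpa [aeval_monomial, Module.algebraMap_end_apply] using
      congrArg (a • ·) (LinearMap.congr_fun hk v)

/-- The squarefree minimal polynomial of `f` also annihilates its quotient `g`. -/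
theorem isSemisimple_of_surjective [FiniteDimensional 𝕜 V] {π : V →ₗ[𝕜] W} {f : End 𝕜 V}
    {g : End 𝕜 W} (hπ : Function.Surjective π) (h : π ∘ₗ f = g ∘ₗ π) (hf : f.IsSemisimple) :
    g.IsSemisimple := by
  refine Module.End.isSemisimple_of_squarefree_aeval_eq_zero hf.minpoly_squarefree ?_
  have := comp_aeval_of_comp_eq h (minpoly 𝕜 f)
  rw [minpoly.aeval, LinearMap.comp_zero] at this
  refine LinearMap.ext fun w => ?_
  obtain ⟨v, rfl⟩ := hπ w
  exact (LinearMap.congr_fun this v).symm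

theorem isNilpotent_of_surjective {π : V →ₗ[𝕜] W} {f : End 𝕜 V}
    {g : End 𝕜 W} (hπ : Function.Surjective π) (h : π ∘ₗ f = g ∘ₗ π) (hf : IsNilpotent f) :
    IsNilpotent g := by
  obtain ⟨k, hk⟩ := hf
  have := comp_aeval_of_comp_eq h (Polynomial.X ^ k)
  rw [aeval_X_pow, aeval_X_pow, hk, LinearMap.comp_zero] at this
  refine ⟨k, LinearMap.ext fun w => ?_⟩
  obtain ⟨v, rfl⟩ := hπ w
  exact (LinearMap.congr_fun this v).symm

/-- Componentwise action of endomorphisms of `V` on tuples of elements of `V`. -/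
def componentwise (ι 𝕜 V : Type*) [Field 𝕜] [AddCommGroup V] [Module 𝕜 V] :
    End 𝕜 V →ₐ[𝕜] End 𝕜 (ι → V) :=
  AlgHom.ofLinearMap
    { toFun := fun f => f.compLeft ι
      map_add' := fun _ _ => rfl
      map_smul' := fun _ _ => rfl } rfl fun _ _ => rfl

@[simp]
theorem componentwise_apply (f : End 𝕜 V) (v : ι → V) (i : ι) :
    componentwise ι 𝕜 V f v i = f (v i) := rfl

/-- Action of square matrices on tuples of elements of a vector space. -/
def matrixAction (ι 𝕜 V : Type*) [Field 𝕜] [AddCommGroup V] [Module 𝕜 V] [Fintype ι]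
    [DecidableEq ι] : Matrix ι ι 𝕜 →ₐ[𝕜] End 𝕜 (ι → V) :=
  AlgHom.ofLinearMap
    { toFun := fun B =>
        { toFun := fun v i => ∑ l, B i l • v l
          map_add' := fun v w => by
            ext i; simp [smul_add, Finset.sum_add_distrib]
          map_smul' := fun c v => by
            ext i; simp [Finset.smul_sum, smul_comm c] }
      map_add' := fun B B' => by
        ext1 v; ext i; simp [add_smul, Finset.sum_add_distrib]
      map_smul' := fun c B => by
        ext1 v; ext i; simp [Finset.smul_sum, mul_smul] }
    (by ext1 v; ext i; simp [Matrix.one_apply, ite_smul])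
    (fun B B' => by
      refine LinearMap.ext fun v => funext fun i => ?_
      change ∑ l, (B * B') i l • v l = ∑ m, B i m • ∑ l, B' m l • v l
      simp only [Matrix.mul_apply, Finset.sum_smul, Finset.smul_sum, mul_smul]
      exact Finset.sum_comm)

@[simp]
theorem matrixAction_apply [Fintype ι] [DecidableEq ι] (B : Matrix ι ι 𝕜) (v : ι → V) (i : ι) :
    matrixAction ι 𝕜 V B v i = ∑ l, B i l • v l := rfl

theorem commute_matrixAction_componentwise [Fintype ι] [DecidableEq ι] (B : Matrix ι ι 𝕜)
    (f : End 𝕜 V) : Commute (matrixAction ι 𝕜 V B) (componentwise ι 𝕜 V f) := by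
  refine LinearMap.ext fun v => funext fun i => ?_
  simp [Module.End.mul_apply]

theorem isSemisimple_algHom_apply {A : Type*} [Ring A] [Algebra 𝕜 A] (F : A →ₐ[𝕜] End 𝕜 V)
    {a : A} {p : 𝕜[X]} (hp : Squarefree p) (ha : aeval a p = 0) : (F a).IsSemisimple :=
  Module.End.isSemisimple_of_squarefree_aeval_eq_zero hp
    (by rw [aeval_algHom_apply, ha, map_zero])

theorem isSemisimple_componentwise [FiniteDimensional 𝕜 V] {f : End 𝕜 V} (hf : f.IsSemisimple) :
    (componentwise ι 𝕜 V f).IsSemisimple :=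
  isSemisimple_algHom_apply _ hf.minpoly_squarefree (minpoly.aeval 𝕜 f)

theorem exists_squarefree_aeval_eq_zero {n : ℕ} {S : Matrix (Fin n) (Fin n) 𝕜}
    (hS : Module.End.IsSemisimple (Matrix.toLin' S)) : ∃ p : 𝕜[X], Squarefree p ∧ aeval S p = 0 := by
  refine ⟨_, hS.minpoly_squarefree, ?_⟩
  rw [Matrix.minpoly_toLin', minpoly.aeval]

theorem aeval_transpose [Fintype ι] [DecidableEq ι] (B : Matrix ι ι 𝕜) (p : 𝕜[X]) :
    aeval B.transpose p = (aeval B p).transpose := by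
  induction p using Polynomial.induction_on' with
  | add p q hp hq => rw [map_add, map_add, hp, hq, Matrix.transpose_add]
  | monomial k a =>
    rw [← C_mul_X_pow_eq_monomial, ← Polynomial.smul_eq_C_mul, map_smul, map_smul, aeval_X_pow,
      aeval_X_pow, Matrix.transpose_smul, Matrix.transpose_pow]

/-- Let `s` be semisimple and `ν` nilpotent, commuting with `s`. Then the kernel of `s` and the
range of `s + ν` span the space. -/
theorem exists_eq_add_of_isSemisimple_of_isNilpotent [FiniteDimensional 𝕜 V] {s ν : End 𝕜 V}
    (hs : s.IsSemisimple) (hν : IsNilpotent ν) (hc : Commute s ν) (v : V) :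
    ∃ k h : V, s k = 0 ∧ k + (s + ν) h = v := by
  -- Fitting decomposition for `s + ν`; `m ≥ 1` places the range of the power inside the range of `s
  -- + ν`.
  obtain ⟨m, hm⟩ := ((s + ν).eventually_isCompl_ker_pow_range_pow.and
    (Filter.eventually_ge_atTop 1)).exists
  obtain ⟨k, hk, w, hw, rfl⟩ := Submodule.mem_sup.mp
    (hm.1.sup_eq_top ▸ Submodule.mem_top : v ∈ _)
  obtain ⟨u, rfl⟩ := hw
  refine ⟨k, ((s + ν) ^ (m - 1)) u, ?_, ?_⟩
  -- A generalized eigenvector of `s + ν` for the eigenvalue `0` is a genuine one for `s`, since `s`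
  -- is semisimple and differs from `s + ν` by a commuting nilpotent.
  · have hk' : k ∈ (s + ν).genEigenspace 0 m := by
      simpa [Module.End.mem_genEigenspace_nat] using hk
    simpa using Module.End.apply_eq_of_mem_of_comm_of_isFinitelySemisimple_of_isNil hk'
      ((Commute.refl s).add_left hc.symm) hs.isFinitelySemisimple (by simpa using hν)
  · rw [← Module.End.mul_apply, ← pow_succ', Nat.sub_add_cancel hm.2]

end LinearAlgebra

/-! ### Linear vector fields, their derivations and their brackets. -/

section LinearDerivation

variable {n : ℕ} {𝕜 : Type*} [Field 𝕜]

theorem linearField_apply (B : Matrix (Fin n) (Fin n) 𝕜) (i : Fin n) :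
    linearField B i = ∑ l, C (B i l) * X l := rfl

theorem linearField_add (B B' : Matrix (Fin n) (Fin n) 𝕜) :
    linearField (B + B') = linearField B + linearField B' := by
  ext1 i
  simp [linearField_apply, add_mul, Finset.sum_add_distrib]

theorem pderiv_linearField (B : Matrix (Fin n) (Fin n) 𝕜) (i k : Fin n) :
    pderiv 𝕜 k (linearField B i) = C (B i k) := by
  classical
  rw [linearField_apply, map_sum]
  simp [Derivation.leibniz, pderiv_X, Pi.single_apply]

theorem linearField_mem_orderIdeal (B : Matrix (Fin n) (Fin n) 𝕜) (i : Fin n) :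
    linearField B i ∈ orderIdeal (Fin n) 𝕜 1 := by
  rw [linearField_apply]
  exact Ideal.sum_mem _ fun l _ => Ideal.mul_mem_left _ _ (X_mem_orderIdeal_one l)

theorem hasLinearPart_iff {g : FormalField 𝕜 n} {B : Matrix (Fin n) (Fin n) 𝕜} :
    HasLinearPart g B ↔ ∀ i, g i - linearField B i ∈ orderIdeal (Fin n) 𝕜 2 := by
  have h0 : ∀ i, constantCoeff (linearField B i) = 0 := fun i =>
    mem_orderIdeal_one.mp (linearField_mem_orderIdeal B i)
  simp only [mem_orderIdeal_two, map_sub, pderiv_linearField, h0, sub_zero, constantCoeff_C,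
    sub_eq_zero]
  refine ⟨fun h i => ⟨h.map_zero i, fun k => ?_⟩, fun h => ⟨fun i => (h i).1, ?_⟩⟩
  · rw [← h.jacobian_zero]; rfl
  · ext i k
    exact (h i).2 k

/-- The derivation `φ ↦ Dφ · Bx`. -/
def linearDerivation (B : Matrix (Fin n) (Fin n) 𝕜) :
    Derivation 𝕜 (MvPowerSeries (Fin n) 𝕜) (MvPowerSeries (Fin n) 𝕜) :=
  ∑ k, linearField B k • pderiv 𝕜 k

theorem linearDerivation_apply (B : Matrix (Fin n) (Fin n) 𝕜) (φ : MvPowerSeries (Fin n) 𝕜) :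
    linearDerivation B φ = ∑ k, linearField B k * pderiv 𝕜 k φ := by
  have h := congrFun (map_sum (Derivation.coeFnAddMonoidHom (R := 𝕜)
    (A := MvPowerSeries (Fin n) 𝕜) (M := MvPowerSeries (Fin n) 𝕜))
    (fun k => linearField B k • pderiv 𝕜 k) Finset.univ) φ
  rw [Finset.sum_apply] at h
  exact h

theorem linearDerivation_add (B B' : Matrix (Fin n) (Fin n) 𝕜) :
    linearDerivation (B + B') = linearDerivation B + linearDerivation B' := by
  simp [linearDerivation, linearField_add, add_smul, Finset.sum_add_distrib]

theorem linearDerivation_X (B : Matrix (Fin n) (Fin n) 𝕜) (i : Fin n) :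
    linearDerivation B (X i) = linearField B i := by
  classical
  simp [linearDerivation_apply, pderiv_X, Pi.single_apply]

theorem linearDerivation_C (B : Matrix (Fin n) (Fin n) 𝕜) (c : 𝕜) :
    linearDerivation B (C c) = 0 := by
  simp [linearDerivation_apply]

theorem homogeneousComponent_X_mul_pderiv (j : ℕ) (l k : Fin n) (φ : MvPowerSeries (Fin n) 𝕜) :
    homogeneousComponent j (X l * pderiv 𝕜 k φ) =
      X l * pderiv 𝕜 k (homogeneousComponent j φ) := by
  ext m
  rw [coeff_homogeneousComponent, coeff_X_mul', coeff_X_mul']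
  by_cases hm : m l = 0
  · simp [hm]
  · have hle : Finsupp.single l 1 ≤ m := by simpa [Nat.one_le_iff_ne_zero] using hm
    have hdeg : (m - Finsupp.single l 1 + Finsupp.single k 1).degree = m.degree := by
      conv_rhs => rw [← tsub_add_cancel_of_le hle]
      simp
    rw [if_neg hm, if_neg hm, coeff_pderiv, coeff_pderiv, coeff_homogeneousComponent, hdeg,
      ite_mul, zero_mul]

theorem homogeneousComponent_C_mul (j : ℕ) (c : 𝕜) (φ : MvPowerSeries (Fin n) 𝕜) :
    homogeneousComponent j (C c * φ) = C c * homogeneousComponent j φ := by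
  rw [← MvPowerSeries.smul_eq_C_mul, map_smul, MvPowerSeries.smul_eq_C_mul]

theorem homogeneousComponent_linearDerivation (j : ℕ) (B : Matrix (Fin n) (Fin n) 𝕜)
    (φ : MvPowerSeries (Fin n) 𝕜) :
    homogeneousComponent j (linearDerivation B φ) =
      linearDerivation B (homogeneousComponent j φ) := by
  simp only [linearDerivation_apply, linearField_apply, Finset.sum_mul, map_sum, mul_assoc,
    homogeneousComponent_C_mul, homogeneousComponent_X_mul_pderiv]

theorem lieBracket_linearField_apply (B : Matrix (Fin n) (Fin n) 𝕜) (g : FormalField 𝕜 n)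
    (i : Fin n) :
    lieBracket (linearField B) g i = linearDerivation B (g i) - ∑ l, C (B i l) * g l := by
  simp only [lieBracket, Pi.sub_apply, Matrix.mulVec, dotProduct, jacobian, Matrix.of_apply,
    pderiv_linearField, linearDerivation_apply]
  simp only [mul_comm]

theorem lieBracket_linearField_add (B : Matrix (Fin n) (Fin n) 𝕜) (g h : FormalField 𝕜 n) :
    lieBracket (linearField B) (g + h) =
      lieBracket (linearField B) g + lieBracket (linearField B) h := by
  ext1 i
  simp only [lieBracket_linearField_apply, Pi.add_apply, map_add, mul_add, Finset.sum_add_distrib]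
  ring

theorem homogeneousPart_lieBracket_linearField (j : ℕ) (B : Matrix (Fin n) (Fin n) 𝕜)
    (g : FormalField 𝕜 n) :
    homogeneousPart j (lieBracket (linearField B) g) =
      lieBracket (linearField B) (homogeneousPart j g) := by
  ext1 i
  simp only [homogeneousPart, lieBracket_linearField_apply, map_sub, map_sum,
    homogeneousComponent_linearDerivation, homogeneousComponent_C_mul]

theorem lieBracket_linearField_mem_orderIdeal {d : ℕ} (B : Matrix (Fin n) (Fin n) 𝕜)
    {g : FormalField 𝕜 n} (hg : ∀ i, g i ∈ orderIdeal (Fin n) 𝕜 (d + 1)) (i : Fin n) :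
    lieBracket (linearField B) g i ∈ orderIdeal (Fin n) 𝕜 (d + 1) := by
  rw [lieBracket_linearField_apply, linearDerivation_apply]
  exact sub_mem (Ideal.sum_mem _ fun k _ => mul_mem_orderIdeal (linearField_mem_orderIdeal B k)
      (pderiv_mem_orderIdeal k (hg i)) (by omega))
    (Ideal.sum_mem _ fun l _ => Ideal.mul_mem_left _ _ (hg l))

/-- Up to sign, the bracket is the linear field of the matrix commutator. -/
theorem lieBracket_linearField_linearField (B B' : Matrix (Fin n) (Fin n) 𝕜)
    (h : Commute B B') : lieBracket (linearField B) (linearField B') = 0 := by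
  have hc : ∀ M M' : Matrix (Fin n) (Fin n) 𝕜, ∀ i,
      ∑ k, C (M i k) * linearField M' k = linearField (M * M') i := by
    intro M M' i
    simp only [linearField_apply, Matrix.mul_apply, map_sum, map_mul, Finset.mul_sum,
      Finset.sum_mul, mul_assoc]
    exact Finset.sum_comm
  ext1 i
  simp only [lieBracket_linearField_apply, linearDerivation_apply, pderiv_linearField, hc]
  simp only [mul_comm _ (C _), hc]
  rw [h.eq, sub_self, Pi.zero_apply]

end LinearDerivation

/-! ### Homogeneous series and the homological equation. -/

section HomogeneousSpace

variable {n : ℕ} {𝕜 : Type*} [Field 𝕜]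

/-- The space of homogeneous power series of degree `j`. -/
def homogeneousSpace (n : ℕ) (𝕜 : Type*) [Field 𝕜] (j : ℕ) :
    Submodule 𝕜 (MvPowerSeries (Fin n) 𝕜) where
  carrier := {φ | homogeneousComponent j φ = φ}
  add_mem' := fun {a b} ha hb => by
    rw [Set.mem_ofPred_eq] at *; rw [map_add, ha, hb]
  zero_mem' := map_zero _
  smul_mem' := fun c φ h => by
    rw [Set.mem_ofPred_eq] at *; rw [map_smul, h]

theorem mem_homogeneousSpace {j : ℕ} {φ : MvPowerSeries (Fin n) 𝕜} :
    φ ∈ homogeneousSpace n 𝕜 j ↔ homogeneousComponent j φ = φ := Iff.rfl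

theorem mem_homogeneousSpace_iff_isHomogeneous {j : ℕ} {φ : MvPowerSeries (Fin n) 𝕜} :
    φ ∈ homogeneousSpace n 𝕜 j ↔ φ.IsHomogeneous j := by
  rw [isHomogeneous_iff_eq_homogeneousComponent, eq_comm]; rfl

theorem homogeneousComponent_mem_homogeneousSpace (j : ℕ) (φ : MvPowerSeries (Fin n) 𝕜) :
    homogeneousComponent j φ ∈ homogeneousSpace n 𝕜 j :=
  mem_homogeneousSpace_iff_isHomogeneous.mpr (isHomogeneous_homogeneousComponent φ j)

theorem linearDerivation_mem_homogeneousSpace (B : Matrix (Fin n) (Fin n) 𝕜) {j : ℕ}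
    {φ : MvPowerSeries (Fin n) 𝕜} (h : φ ∈ homogeneousSpace n 𝕜 j) :
    linearDerivation B φ ∈ homogeneousSpace n 𝕜 j := by
  rw [mem_homogeneousSpace] at *
  rw [homogeneousComponent_linearDerivation, h]

theorem X_mul_mem_homogeneousSpace {j : ℕ} (i : Fin n) {φ : MvPowerSeries (Fin n) 𝕜}
    (h : φ ∈ homogeneousSpace n 𝕜 j) : X i * φ ∈ homogeneousSpace n 𝕜 (j + 1) := by
  rw [mem_homogeneousSpace_iff_isHomogeneous] at *
  rw [add_comm]
  refine IsHomogeneous.mul ?_ h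
  intro m hm
  classical
  rw [coeff_X] at hm
  rw [of_not_not fun h => hm (if_neg h)]
  simp [Finsupp.weight_single]

/-- The endomorphism `φ ↦ Dφ · Bx` of the space of homogeneous power series of degree `j`. -/
def homogeneousDerivation (j : ℕ) (B : Matrix (Fin n) (Fin n) 𝕜) :
    Module.End 𝕜 (homogeneousSpace n 𝕜 j) :=
  (linearDerivation B).toLinearMap.restrict fun _ h => linearDerivation_mem_homogeneousSpace B h

@[simp]
theorem coe_homogeneousDerivation (j : ℕ) (B : Matrix (Fin n) (Fin n) 𝕜)
    (φ : homogeneousSpace n 𝕜 j) :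
    (homogeneousDerivation j B φ : MvPowerSeries (Fin n) 𝕜) = linearDerivation B φ := rfl

/-- The map `(φ_i) ↦ ∑ x_i φ_i`. -/
def sumXMul (n : ℕ) (𝕜 : Type*) [Field 𝕜] (j : ℕ) :
    (Fin n → homogeneousSpace n 𝕜 j) →ₗ[𝕜] homogeneousSpace n 𝕜 (j + 1) where
  toFun v := ⟨∑ i, X i * (v i : MvPowerSeries (Fin n) 𝕜),
    Submodule.sum_mem _ fun i _ => X_mul_mem_homogeneousSpace i (v i).2⟩
  map_add' v w := by
    ext1; simp [mul_add, Finset.sum_add_distrib]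
  map_smul' c v := by
    ext1; simp [Finset.smul_sum]

@[simp]
theorem coe_sumXMul (j : ℕ) (v : Fin n → homogeneousSpace n 𝕜 j) :
    (sumXMul n 𝕜 j v : MvPowerSeries (Fin n) 𝕜) = ∑ i, X i * (v i : MvPowerSeries (Fin n) 𝕜) :=
  rfl

theorem sumXMul_surjective [CharZero 𝕜] (j : ℕ) : Function.Surjective (sumXMul n 𝕜 j) := by
  rintro ⟨φ, hφ⟩
  rw [mem_homogeneousSpace_iff_isHomogeneous] at hφ
  refine ⟨fun i => ⟨hadamardQuotient i φ, mem_homogeneousSpace_iff_isHomogeneous.mpr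
    (isHomogeneous_hadamardQuotient hφ i)⟩, Subtype.ext ?_⟩
  have h0 : constantCoeff φ = 0 := mem_orderIdeal_one.mp
    (orderIdeal_anti (by omega) (mem_orderIdeal_of_isHomogeneous hφ))
  have := eq_C_add_sum_X_mul_hadamardQuotient φ
  rw [h0, map_zero, zero_add] at this
  exact this.symm

/-- Leibniz's rule: differentiating `φ_i` gives the componentwise part, and differentiating `x_i`
gives row `i` of `B` applied to the variables, which after regrouping acts on the tuple by the
transpose. The two parts commute, so commutation, nilpotency and semisimplicity pass from degree `j`
to degree `j + 1`. -/
theorem sumXMul_comp (j : ℕ) (B : Matrix (Fin n) (Fin n) 𝕜) :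
    sumXMul n 𝕜 j ∘ₗ (matrixAction (Fin n) 𝕜 _ B.transpose +
      componentwise (Fin n) 𝕜 _ (homogeneousDerivation j B)) =
      homogeneousDerivation (j + 1) B ∘ₗ sumXMul n 𝕜 j := by
  refine LinearMap.ext fun v => Subtype.ext ?_
  simp only [LinearMap.comp_apply, LinearMap.add_apply, coe_homogeneousDerivation, coe_sumXMul,
    Pi.add_apply, matrixAction_apply, componentwise_apply, Submodule.coe_add, Submodule.coe_sum,
    Submodule.coe_smul, map_sum, Derivation.leibniz, linearDerivation_X, smul_eq_mul, mul_add,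
    Finset.sum_add_distrib, Matrix.transpose_apply]
  rw [add_comm]
  congr 1
  simp only [linearField_apply, Finset.mul_sum, MvPowerSeries.smul_eq_C_mul]
  rw [Finset.sum_comm]
  exact Finset.sum_congr rfl fun _ _ => Finset.sum_congr rfl fun _ _ => by ring

theorem eq_C_of_mem_homogeneousSpace_zero {φ : MvPowerSeries (Fin n) 𝕜}
    (h : φ ∈ homogeneousSpace n 𝕜 0) : φ = C (constantCoeff φ) := by
  classical
  ext m
  rw [coeff_C]
  split_ifs with hm
  · rw [hm, coeff_zero_eq_constantCoeff_apply]
  · exact IsHomogeneous.coeff_eq_zero (mem_homogeneousSpace_iff_isHomogeneous.mp h)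
      fun h' => hm ((Finsupp.degree_eq_zero_iff m).mp h')

theorem homogeneousDerivation_zero (B : Matrix (Fin n) (Fin n) 𝕜) :
    homogeneousDerivation 0 B = 0 := by
  refine LinearMap.ext fun φ => Subtype.ext ?_
  rw [coe_homogeneousDerivation, eq_C_of_mem_homogeneousSpace_zero φ.2, linearDerivation_C]
  rfl

theorem finiteDimensional_homogeneousSpace [CharZero 𝕜] (j : ℕ) :
    FiniteDimensional 𝕜 (homogeneousSpace n 𝕜 j) := by
  induction j with
  | zero =>
    let c : homogeneousSpace n 𝕜 0 →ₗ[𝕜] 𝕜 :=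
      (coeff (0 : Fin n →₀ ℕ)).comp (homogeneousSpace n 𝕜 0).subtype
    refine FiniteDimensional.of_injective c fun φ ψ h => Subtype.ext ?_
    rw [eq_C_of_mem_homogeneousSpace_zero φ.2, eq_C_of_mem_homogeneousSpace_zero ψ.2]
    exact congrArg _ h
  | succ j ih => exact Module.Finite.of_surjective _ (sumXMul_surjective j)

theorem commute_homogeneousDerivation [CharZero 𝕜] {B B' : Matrix (Fin n) (Fin n) 𝕜}
    (h : Commute B B') (j : ℕ) :
    Commute (homogeneousDerivation j B) (homogeneousDerivation j B') := by
  induction j with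
  | zero => rw [homogeneousDerivation_zero]; exact Commute.zero_left _
  | succ j ih =>
    have ht : Commute B.transpose B'.transpose := by
      rw [Commute, SemiconjBy, ← Matrix.transpose_mul, ← Matrix.transpose_mul, h.eq]
    have hc := ((ht.map (matrixAction (Fin n) 𝕜 (homogeneousSpace n 𝕜 j))).add_left
        (commute_matrixAction_componentwise B'.transpose (homogeneousDerivation j B)).symm).add_right
      ((commute_matrixAction_componentwise B.transpose (homogeneousDerivation j B')).add_left
        (ih.map (componentwise (Fin n) 𝕜 (homogeneousSpace n 𝕜 j))))
    refine LinearMap.ext fun φ => ?_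
    obtain ⟨v, rfl⟩ := sumXMul_surjective j φ
    have e := fun M w => LinearMap.congr_fun (sumXMul_comp (n := n) (𝕜 := 𝕜) j M) w
    simp only [LinearMap.comp_apply] at e
    rw [Module.End.mul_apply, Module.End.mul_apply, ← e, ← e, ← e, ← e]
    exact congrArg _ (LinearMap.congr_fun hc v)

theorem isNilpotent_transpose {N : Matrix (Fin n) (Fin n) 𝕜} (hN : IsNilpotent N) :
    IsNilpotent N.transpose := by
  obtain ⟨k, hk⟩ := hN
  exact ⟨k, by rw [← Matrix.transpose_pow, hk, Matrix.transpose_zero]⟩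

theorem isNilpotent_homogeneousDerivation [CharZero 𝕜] {N : Matrix (Fin n) (Fin n) 𝕜}
    (hN : IsNilpotent N) (j : ℕ) : IsNilpotent (homogeneousDerivation j N) := by
  induction j with
  | zero => rw [homogeneousDerivation_zero]; exact IsNilpotent.zero
  | succ j ih =>
    exact isNilpotent_of_surjective (sumXMul_surjective j) (sumXMul_comp j N)
      ((commute_matrixAction_componentwise _ _).isNilpotent_add
        ((isNilpotent_transpose hN).map _) (ih.map _))

/-- In characteristic zero a sum of commuting semisimple operators is semisimple, and so is its
quotient under `sumXMul`. -/
theorem isSemisimple_homogeneousDerivation [CharZero 𝕜] {S : Matrix (Fin n) (Fin n) 𝕜}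
    (hS : Module.End.IsSemisimple (Matrix.toLin' S)) (j : ℕ) :
    (homogeneousDerivation j S).IsSemisimple := by
  induction j with
  | zero => rw [homogeneousDerivation_zero]; exact Module.End.isSemisimple_zero
  | succ j ih =>
    have := finiteDimensional_homogeneousSpace (n := n) (𝕜 := 𝕜) j
    obtain ⟨p, hp, hpS⟩ := exists_squarefree_aeval_eq_zero hS
    exact isSemisimple_of_surjective (sumXMul_surjective j) (sumXMul_comp j S)
      ((isSemisimple_algHom_apply _ hp (by rw [aeval_transpose, hpS, Matrix.transpose_zero])
        ).add_of_commute (commute_matrixAction_componentwise _ _) (isSemisimple_componentwise ih))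

/-- The endomorphism `[Bx, ·]` of the space of homogeneous vector fields of degree `j`. -/
def adHomogeneous (j : ℕ) (B : Matrix (Fin n) (Fin n) 𝕜) :
    Module.End 𝕜 (Fin n → homogeneousSpace n 𝕜 j) :=
  componentwise (Fin n) 𝕜 _ (homogeneousDerivation j B) - matrixAction (Fin n) 𝕜 _ B

theorem coe_adHomogeneous (j : ℕ) (B : Matrix (Fin n) (Fin n) 𝕜)
    (v : Fin n → homogeneousSpace n 𝕜 j) (i : Fin n) :
    (adHomogeneous j B v i : MvPowerSeries (Fin n) 𝕜) =
      lieBracket (linearField B) (fun i => (v i : MvPowerSeries (Fin n) 𝕜)) i := by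
  simp [adHomogeneous, lieBracket_linearField_apply, MvPowerSeries.smul_eq_C_mul]

theorem adHomogeneous_add (j : ℕ) (B B' : Matrix (Fin n) (Fin n) 𝕜) :
    adHomogeneous j (B + B') = adHomogeneous j B + adHomogeneous j B' := by
  have : homogeneousDerivation j (B + B') =
      homogeneousDerivation j B + homogeneousDerivation j B' := by
    refine LinearMap.ext fun φ => Subtype.ext ?_
    simp [linearDerivation_add]
  rw [adHomogeneous, this, map_add, map_add, adHomogeneous, adHomogeneous]
  abel

/-- The homological equation: every homogeneous vector field `e` is of the form `k + [A, h]` with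
`[A_s, k] = 0`. -/
theorem exists_homological_solution [CharZero 𝕜] {A S N : Matrix (Fin n) (Fin n) 𝕜}
    (hA : IsJordanChevalley A S N) (j : ℕ) {e : FormalField 𝕜 n}
    (he : ∀ i, e i ∈ homogeneousSpace n 𝕜 j) :
    ∃ k h : FormalField 𝕜 n, (∀ i, k i ∈ homogeneousSpace n 𝕜 j) ∧
      (∀ i, h i ∈ homogeneousSpace n 𝕜 j) ∧ lieBracket (linearField S) k = 0 ∧
      k + lieBracket (linearField A) h = e := by
  have := finiteDimensional_homogeneousSpace (n := n) (𝕜 := 𝕜) j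
  obtain ⟨p, hp, hpS⟩ := exists_squarefree_aeval_eq_zero hA.semisimple
  let cw := componentwise (Fin n) 𝕜 (homogeneousSpace n 𝕜 j)
  let ma := matrixAction (Fin n) 𝕜 (homogeneousSpace n 𝕜 j)
  have hcomm : ∀ B D, Commute (ma B) (cw D) := fun B D => commute_matrixAction_componentwise B D
  have hs : (adHomogeneous j S).IsSemisimple :=
    (isSemisimple_componentwise (isSemisimple_homogeneousDerivation hA.semisimple j)
      ).sub_of_commute (hcomm _ _).symm (isSemisimple_algHom_apply ma hp hpS)
  have hν : IsNilpotent (adHomogeneous j N) := by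
    have h1 := (isNilpotent_homogeneousDerivation hA.nilpotent j).map cw
    have h2 := hA.nilpotent.map ma
    exact Commute.isNilpotent_sub (R := Module.End 𝕜 (Fin n → homogeneousSpace n 𝕜 j))
      (hcomm N (homogeneousDerivation j N)).symm h1 h2
  have hc : Commute (adHomogeneous j S) (adHomogeneous j N) := by
    have h1 := (commute_homogeneousDerivation hA.commute j).map cw
    have h2 := hA.commute.map ma
    exact Commute.sub_right (R := Module.End 𝕜 (Fin n → homogeneousSpace n 𝕜 j))
      (Commute.sub_left (R := Module.End 𝕜 (Fin n → homogeneousSpace n 𝕜 j)) h1 (hcomm _ _))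
      (Commute.sub_left (R := Module.End 𝕜 (Fin n → homogeneousSpace n 𝕜 j)) (hcomm _ _).symm h2)
  obtain ⟨k, h, hk, hkh⟩ := exists_eq_add_of_isSemisimple_of_isNilpotent hs hν hc
    (fun i => ⟨e i, he i⟩)
  rw [← adHomogeneous_add, ← hA.add_eq] at hkh
  refine ⟨fun i => k i, fun i => h i, fun i => (k i).2, fun i => (h i).2, ?_, ?_⟩
  · ext1 i
    rw [← coe_adHomogeneous, hk]
    rfl
  · ext1 i
    rw [Pi.add_apply, ← coe_adHomogeneous]
    exact congrArg (fun v : Fin n → homogeneousSpace n 𝕜 j => (v i : MvPowerSeries (Fin n) 𝕜)) hkh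

end HomogeneousSpace

/-! ### Successive normalization, passage to the limit and the degreewise criterion. -/

section NormalForm

variable {n : ℕ} {𝕜 : Type*} [Field 𝕜]

/-- The defect `DΦ · F - f ∘ Φ` of `Φ` being solution-preserving from `F` to `f`. -/
def defect (f Φ F : FormalField 𝕜 n) : FormalField 𝕜 n := (jacobian Φ).mulVec F - comp f Φ

theorem defect_apply (f Φ F : FormalField 𝕜 n) (i : Fin n) :
    defect f Φ F i = ∑ l, pderiv 𝕜 l (Φ i) * F l - subst Φ (f i) := rfl

variable {A : Matrix (Fin n) (Fin n) 𝕜} {f Φ F h k : FormalField 𝕜 n}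

theorem linearField_one : linearField (1 : Matrix (Fin n) (Fin n) 𝕜) = X := by
  ext1 i
  simp [linearField_apply, Matrix.one_apply, apply_ite C]

theorem HasLinearPart.mem_orderIdeal_one (hf : HasLinearPart f A) (i : Fin n) :
    f i ∈ orderIdeal (Fin n) 𝕜 1 :=
  PoincareDulac.mem_orderIdeal_one.mpr (hf.map_zero i)

theorem HasLinearPart.add (hf : HasLinearPart f A) (hh : ∀ i, h i ∈ orderIdeal (Fin n) 𝕜 2) :
    HasLinearPart (f + h) A := by
  rw [hasLinearPart_iff] at *
  intro i
  rw [Pi.add_apply, add_sub_right_comm]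
  exact add_mem (hf i) (hh i)

theorem hasLinearPart_linearField (A : Matrix (Fin n) (Fin n) 𝕜) :
    HasLinearPart (linearField A) A := by
  rw [hasLinearPart_iff]
  simp

/-- Adding terms `h`, `k` of order `d ≥ 2` to `Φ` and `F` changes the defect by `k + [A, h]` up to
terms of higher order. -/
theorem defect_add_mem_orderIdeal [CharZero 𝕜] {d : ℕ} (hf : HasLinearPart f A)
    (hΦ : HasLinearPart Φ 1) (hF : HasLinearPart F A)
    (hh : ∀ i, h i ∈ orderIdeal (Fin n) 𝕜 (d + 2))
    (hk : ∀ i, k i ∈ orderIdeal (Fin n) 𝕜 (d + 2)) (i : Fin n) :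
    defect f (Φ + h) (F + k) i - defect f Φ F i - (k + lieBracket (linearField A) h) i ∈
      orderIdeal (Fin n) 𝕜 (d + 3) := by
  classical
  have hF' := hasLinearPart_iff.mp hF
  have hΦ' := hasLinearPart_iff.mp hΦ
  rw [linearField_one] at hΦ'
  have hh2 : ∀ i, h i ∈ orderIdeal (Fin n) 𝕜 2 := fun i => orderIdeal_anti (by omega) (hh i)
  have hA : ∀ l, constantCoeff (pderiv 𝕜 l (f i)) = A i l := fun l => by
    rw [← hf.jacobian_zero]; rfl
  have taylor := subst_sub_subst_sub_linear_mem_orderIdeal hΦ.mem_orderIdeal_one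
    (hΦ.add hh2).mem_orderIdeal_one (d := d + 2) (fun i => by simpa using hh i) (f i)
  simp only [hA, Pi.add_apply, add_sub_cancel_left] at taylor
  have hX : ∑ l, pderiv 𝕜 l (X i : MvPowerSeries (Fin n) 𝕜) * k l = k i := by
    simp [pderiv_X, Pi.single_apply]
  -- The terms `Dh · Ax`, `k` and `-Ah` cancel against `k + [A, h]`. The remaining products have
  -- order at least `(d + 1) + 2`, `(d + 1) + (d + 2)` and `1 + (d + 2)`; the last bracket is the
  -- Taylor remainder.
  have e : defect f (Φ + h) (F + k) i - defect f Φ F i - (k + lieBracket (linearField A) h) i =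
      (∑ l, pderiv 𝕜 l (h i) * (F l - linearField A l) + ∑ l, pderiv 𝕜 l (h i) * k l +
        ∑ l, pderiv 𝕜 l (Φ i - X i) * k l) -
      (subst (Φ + h) (f i) - subst Φ (f i) - ∑ l, C (A i l) * h l) := by
    simp only [defect_apply, Pi.add_apply, lieBracket_linearField_apply, linearDerivation_apply,
      map_add, map_sub, mul_add, add_mul, mul_sub, sub_mul, Finset.sum_add_distrib,
      Finset.sum_sub_distrib, hX, mul_comm (linearField A _)]
    ring
  rw [e]
  refine sub_mem (add_mem (add_mem ?_ ?_) ?_) taylor <;> refine Ideal.sum_mem _ fun l _ => ?_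
  · exact mul_mem_orderIdeal (pderiv_mem_orderIdeal l (hh i)) (hF' l) (by omega)
  · exact mul_mem_orderIdeal (pderiv_mem_orderIdeal l (hh i)) (hk l) (by omega)
  · exact mul_mem_orderIdeal (pderiv_mem_orderIdeal l (hΦ' i)) (hk l) (by omega)

/-- The pair `(Φ, F)` solves the normal form problem for `f` up to terms of order `d`. -/
structure IsApproximateNormalization (A S : Matrix (Fin n) (Fin n) 𝕜) (f : FormalField 𝕜 n)
    (d : ℕ) (P : FormalField 𝕜 n × FormalField 𝕜 n) : Prop where
  left : HasLinearPart P.1 1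
  right : HasLinearPart P.2 A
  bracket : lieBracket (linearField S) P.2 = 0
  defect_mem : ∀ i, defect f P.1 P.2 i ∈ orderIdeal (Fin n) 𝕜 d

variable {S N : Matrix (Fin n) (Fin n) 𝕜}

theorem IsJordanChevalley.commute_left (hA : IsJordanChevalley A S N) : Commute S A := by
  rw [hA.add_eq]
  exact (Commute.refl S).add_right hA.commute

theorem isApproximateNormalization_linear (hA : IsJordanChevalley A S N)
    (hf : HasLinearPart f A) : IsApproximateNormalization A S f 2 (X, linearField A) where
  left := linearField_one (𝕜 := 𝕜) (n := n) ▸ hasLinearPart_linearField 1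
  right := hasLinearPart_linearField A
  bracket := lieBracket_linearField_linearField S A hA.commute_left
  defect_mem i := by
    classical
    have h1 : ∑ l, pderiv 𝕜 l (X i : MvPowerSeries (Fin n) 𝕜) * linearField A l =
        linearField A i := by
      simp [pderiv_X, Pi.single_apply]
    rw [defect_apply, h1, subst_self, id, ← neg_sub]
    exact neg_mem (hasLinearPart_iff.mp hf i)

theorem IsApproximateNormalization.exists_next [CharZero 𝕜] (hA : IsJordanChevalley A S N)
    (hf : HasLinearPart f A) {d : ℕ} {P : FormalField 𝕜 n × FormalField 𝕜 n}
    (hP : IsApproximateNormalization A S f (d + 2) P) :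
    ∃ Q, IsApproximateNormalization A S f (d + 3) Q ∧
      (∀ i, Q.1 i - P.1 i ∈ orderIdeal (Fin n) 𝕜 (d + 2)) ∧
      ∀ i, Q.2 i - P.2 i ∈ orderIdeal (Fin n) 𝕜 (d + 2) := by
  -- The right-hand side is minus the leading part of the defect, so that the correction cancels it.
  obtain ⟨k, h, hk, hh, hSk, hkh⟩ := exists_homological_solution hA (d + 2)
    (e := fun i => -homogeneousComponent (d + 2) (defect f P.1 P.2 i))
    fun i => neg_mem (homogeneousComponent_mem_homogeneousSpace _ _)
  have hom : ∀ {φ : MvPowerSeries (Fin n) 𝕜}, φ ∈ homogeneousSpace n 𝕜 (d + 2) →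
      φ ∈ orderIdeal (Fin n) 𝕜 (d + 2) := fun hφ =>
    mem_orderIdeal_of_isHomogeneous (mem_homogeneousSpace_iff_isHomogeneous.mp hφ)
  have two : ∀ {φ : MvPowerSeries (Fin n) 𝕜}, φ ∈ orderIdeal (Fin n) 𝕜 (d + 2) →
      φ ∈ orderIdeal (Fin n) 𝕜 2 := fun hφ => orderIdeal_anti (by omega) hφ
  refine ⟨(P.1 + h, P.2 + k), ⟨hP.left.add fun i => two (hom (hh i)),
    hP.right.add fun i => two (hom (hk i)), ?_, fun i => ?_⟩,
    fun i => by simpa using hom (hh i), fun i => by simpa using hom (hk i)⟩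
  · rw [lieBracket_linearField_add, hP.bracket, hSk, add_zero]
  · have h1 := defect_add_mem_orderIdeal hf hP.left hP.right (fun i => hom (hh i))
      (fun i => hom (hk i)) i
    rw [hkh, sub_neg_eq_add, sub_add] at h1
    have h2 : defect f P.1 P.2 i - homogeneousComponent (d + 2) (defect f P.1 P.2 i) ∈
        orderIdeal (Fin n) 𝕜 (d + 3) := by
      refine mem_orderIdeal_succ (sub_mem (hP.defect_mem i)
        (hom (homogeneousComponent_mem_homogeneousSpace _ _))) ?_
      rw [map_sub, mem_homogeneousSpace.mp (homogeneousComponent_mem_homogeneousSpace _ _),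
        sub_self]
    simpa using add_mem h1 h2

theorem exists_normalization [CharZero 𝕜] (hA : IsJordanChevalley A S N)
    (hf : HasLinearPart f A) :
    ∃ Φ F : FormalField 𝕜 n, HasLinearPart Φ 1 ∧ HasLinearPart F A ∧
      IsSolutionPreserving Φ F f ∧ lieBracket (linearField S) F = 0 := by
  choose! next hnext using
    fun (d : ℕ) (P : FormalField 𝕜 n × FormalField 𝕜 n)
      (hP : IsApproximateNormalization A S f (d + 2) P) => hP.exists_next hA hf
  let u : ℕ → FormalField 𝕜 n × FormalField 𝕜 n :=
    fun d => Nat.rec (X, linearField A) next d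
  have hu : ∀ d, IsApproximateNormalization A S f (d + 2) (u d) := by
    intro d
    induction d with
    | zero => exact isApproximateNormalization_linear hA hf
    | succ d ih => exact (hnext d (u d) ih).1
  choose Φ hΦ using fun i => exists_limit_of_stabilizing (fun d => (u d).1 i) 2
    fun d => (hnext d (u d) (hu d)).2.1 i
  choose F hF using fun i => exists_limit_of_stabilizing (fun d => (u d).2 i) 2
    fun d => (hnext d (u d) (hu d)).2.2 i
  have eΦ : ∀ d, Φ = (u d).1 + (Φ - (u d).1) := fun d => (add_sub_cancel _ _).symm
  have eF : ∀ d, F = (u d).2 + (F - (u d).2) := fun d => (add_sub_cancel _ _).symm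
  refine ⟨Φ, F, ?_, ?_, ?_, ?_⟩
  · rw [eΦ 0]
    exact (hu 0).left.add fun i => hΦ i 0
  · rw [eF 0]
    exact (hu 0).right.add fun i => hF i 0
  -- The limit is a correction of order `d + 2` to stage `d`, so its defect differs from that of
  -- stage `d` by terms of order `d + 2`. It therefore has arbitrarily high order.
  · refine (sub_eq_zero (a := (jacobian Φ).mulVec F)).mp (funext fun i => ?_)
    change defect f Φ F i = 0
    refine eq_zero_of_forall_mem_orderIdeal (k := 2) fun d hd => ?_
    obtain ⟨d, rfl⟩ := Nat.exists_eq_add_of_le' hd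
    have h1 := defect_add_mem_orderIdeal hf (hu d).left (hu d).right
      (h := Φ - (u d).1) (k := F - (u d).2) (fun i => hΦ i d) (fun i => hF i d) i
    rw [← eΦ, ← eF] at h1
    have h2 := orderIdeal_anti (Nat.le_succ (d + 2)) h1
    have h3 : (F - (u d).2 + lieBracket (linearField A) (Φ - (u d).1)) i ∈
        orderIdeal (Fin n) 𝕜 (d + 2) :=
      add_mem (hF i d) (lieBracket_linearField_mem_orderIdeal (d := d + 1) A (fun i => hΦ i d) i)
    have h4 := add_mem (add_mem h2 h3) ((hu d).defect_mem i)
    simpa using h4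
  · refine funext fun i => eq_zero_of_forall_mem_orderIdeal (k := 2) fun d hd => ?_
    obtain ⟨d, rfl⟩ := Nat.exists_eq_add_of_le' hd
    rw [eF d, lieBracket_linearField_add, (hu d).bracket, zero_add]
    exact lieBracket_linearField_mem_orderIdeal (d := d + 1) S (fun i => hF i d) i

theorem homogeneousPart_zero_of_hasLinearPart (hf : HasLinearPart f A) :
    homogeneousPart 0 f = 0 := by
  ext1 i
  have h := eq_C_of_mem_homogeneousSpace_zero
    (homogeneousComponent_mem_homogeneousSpace 0 (f i))
  have h0 : constantCoeff (homogeneousComponent 0 (f i)) = 0 := by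
    rw [← coeff_zero_eq_constantCoeff_apply, coeff_homogeneousComponent,
      coeff_zero_eq_constantCoeff_apply, hf.map_zero, ite_self]
  rw [h0, map_zero] at h
  exact h

theorem homogeneousPart_one_of_hasLinearPart (hf : HasLinearPart f A) :
    homogeneousPart 1 f = linearField A := by
  ext1 i
  refine MvPowerSeries.ext fun m => ?_
  rw [homogeneousPart, coeff_homogeneousComponent]
  have h := mem_orderIdeal.mp (hasLinearPart_iff.mp hf i) m
  rw [map_sub, sub_eq_zero] at h
  split_ifs with hm
  · exact h (by omega)
  · rw [linearField_apply, map_sum, eq_comm]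
    refine Finset.sum_eq_zero fun l _ => ?_
    classical
    rw [← MvPowerSeries.smul_eq_C_mul, map_smul, coeff_X, if_neg, smul_zero]
    rintro rfl
    simp at hm

/-- Bracketing with a linear field preserves the degree, so the equation splits into its homogeneous
parts. -/
theorem lieBracket_linearField_eq_zero_iff (B : Matrix (Fin n) (Fin n) 𝕜) (g : FormalField 𝕜 n) :
    lieBracket (linearField B) g = 0 ↔
      ∀ j, lieBracket (linearField B) (homogeneousPart j g) = 0 := by
  simp only [← homogeneousPart_lieBracket_linearField]
  refine ⟨fun h j => ?_, fun h => funext fun i => MvPowerSeries.ext fun m => ?_⟩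
  · rw [h]
    exact funext fun i => map_zero _
  · simpa [homogeneousPart, coeff_homogeneousComponent] using
      congrArg (coeff m) (congrFun (h m.degree) i)

/-- Degrees `0` and `1` impose nothing: the constant part is zero, and the linear part `A` commutes
with `S`. -/
theorem lieBracket_eq_zero_iff_forall_two_le (hA : IsJordanChevalley A S N)
    (hf : HasLinearPart f A) : lieBracket (linearField S) f = 0 ↔
      ∀ j, 2 ≤ j → lieBracket (linearField S) (homogeneousPart j f) = 0 := by
  rw [lieBracket_linearField_eq_zero_iff]
  refine ⟨fun h j _ => h j, fun h j => ?_⟩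
  match j with
  | 0 =>
    rw [homogeneousPart_zero_of_hasLinearPart hf]
    ext1 i
    simp [lieBracket_linearField_apply]
  | 1 =>
    rw [homogeneousPart_one_of_hasLinearPart hf]
    exact lieBracket_linearField_linearField S A hA.commute_left
  | j + 2 => exact h _ (by omega)

theorem isJordanChevalley_semisimplePart [PerfectField 𝕜] (B : Matrix (Fin n) (Fin n) 𝕜) :
    ∃ N, IsJordanChevalley B (semisimplePart B) N :=
  Classical.choose_spec (exists_isJordanChevalley B)

end NormalForm

end PoincareDulac

end

theorem theorem4p13 {𝕜 : Type*} [RCLike 𝕜] {n : ℕ} (A : Matrix (Fin n) (Fin n) 𝕜)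
    (f : PoincareDulac.FormalField 𝕜 n) (hf : PoincareDulac.HasLinearPart f A) :
    (∃ Φ fstar : PoincareDulac.FormalField 𝕜 n,
      PoincareDulac.HasLinearPart Φ 1 ∧
      PoincareDulac.HasLinearPart fstar A ∧
      PoincareDulac.IsSolutionPreserving Φ fstar f ∧
      PoincareDulac.IsNormalForm A fstar) ∧
    (∀ g : PoincareDulac.FormalField 𝕜 n, PoincareDulac.HasLinearPart g A →
      (PoincareDulac.IsNormalForm A g ↔
        ∀ j : ℕ, 2 ≤ j → PoincareDulac.lieBracket
          (PoincareDulac.linearField (PoincareDulac.semisimplePart A))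
          (PoincareDulac.homogeneousPart j g) = 0)) := by
  obtain ⟨N, hA⟩ := PoincareDulac.isJordanChevalley_semisimplePart A
  exact ⟨PoincareDulac.exists_normalization hA hf,
    fun _ hg => PoincareDulac.lieBracket_eq_zero_iff_forall_two_le hA hg⟩
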